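/- Let $\mathcal M_0=\{\Sigma : \sigma_{12}=0\}$ and $\mathcal M_1=\{\Sigma : \sigma_{12}\sigma_{33}=\sigma_{13}\sigma_{23}\}$ as subsets of the real symmetric positive definite $3\times 3$ matrices $\Sigma=(\sigma_{jk})$; for a centred Gaussian vector $(X_1,X_2,X_3)\sim\mathcal N(0,\Sigma)$ they express $X_1\perp X_2$ and $X_1\perp X_2\mid X_3$, respectively. For a sample $x_1,\dots,x_n\in\mathbb R^3$ put $S_n=\frac1n\sum_{m=1}^n x_mx_m^{\mathsf T}$, $\ell_n(\Sigma)=\frac n2\bigl(-\log\det\Sigma-\operatorname{tr}(S_n\Sigma^{-1})\bigr)$ and $$\lambda_n^{(0:1)}=2\Bigl(\sup_{\Sigma\in\mathcal M_0}\ell_n(\Sigma)-\sup_{\Sigma\in\mathcal M_1}\ell_n(\Sigma)\Bigr).$$ Let $i\in\{0,1\}$, $\delta\in\mathbb R\setminus\{0\}$, and let $\Sigma_n\in\mathcal M_i\setminus\mathcal M_{1-i}$ $(n\ge 1)$ be any sequence whose correlation coefficients $\rho_{jk,n}=\sigma_{jk,n}/\sqrt{\sigma_{jj,n}\sigma_{kk,n}}$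 satisfy, as $n\to\infty$, $\rho_{13,n}\to0$, $\rho_{23,n}\to0$ and $$\rho_{13,n}\,\rho_{23,n}=\delta n^{-1/2}+o(n^{-1/2}).$$ For each $n$ let $x_1,\dots,x_n$ be independent with law $\mathcal N(0,\Sigma_n)$. Then for every $n\ge3$ both suprema are almost surely finite, and $$\lambda_n^{(0:1)}\ \xrightarrow{\ d\ }\ \delta\bigl(2Z+(-1)^i\delta\bigr)\ =_d\ \mathcal N\bigl((-1)^i\delta^2,\,(2\delta)^2\bigr),\qquad Z\sim\mathcal N(0,1).$$ In particular the limit law does not depend on how $\rho_{13,n}$ and $\rho_{23,n}$ individually tend to zero. -/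

import Mathlib

open MeasureTheory ProbabilityTheory Filter Topology Asymptotics

noncomputable section

namespace TrivariateGaussian

/-- The two models inside the parameter space of positive definite `3 × 3` covariance matrices.
Coordinates `1, 2, 3` of the random vector are the indices `0, 1, 2`.
Model `0` is marginal independence of the first two coordinates (`σ₁₂ = 0`), model `1` is their
conditional independence given the third one (`σ₁₂ σ₃₃ = σ₁₃ σ₂₃`). -/
def model : Fin 2 → Set (Matrix (Fin 3) (Fin 3) ℝ)
  | 0 => {C | C.PosDef ∧ C 0 1 = 0}
  | 1 => {C | C.PosDef ∧ C 0 1 * C 2 2 = C 0 2 * C 1 2}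

/-- The correlation coefficient between coordinates `j` and `k` of a covariance matrix. -/
def corr (C : Matrix (Fin 3) (Fin 3) ℝ) (j k : Fin 3) : ℝ :=
  C j k / Real.sqrt (C j j * C k k)

/-- The law of `n` independent observations from the centred Gaussian law with covariance `C`. -/
def sampleLaw (n : ℕ) (C : Matrix (Fin 3) (Fin 3) ℝ) :
    Measure (Fin n → EuclideanSpace ℝ (Fin 3)) :=
  Measure.pi fun _ => multivariateGaussian 0 C

instance (n : ℕ) (C : Matrix (Fin 3) (Fin 3) ℝ) : IsProbabilityMeasure (sampleLaw n C) := by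
  unfold sampleLaw; infer_instance

/-- The sample covariance computed with respect to mean zero. -/
def sampleCov (n : ℕ) (x : Fin n → EuclideanSpace ℝ (Fin 3)) : Matrix (Fin 3) (Fin 3) ℝ :=
  Matrix.of fun j k => (∑ m, x m j * x m k) / n

/-- The Gaussian log-likelihood of the covariance `C` for sample size `n` and sample
covariance `S`, up to the additive constant `-(3 n / 2) log (2 π)`. -/
def logLik (n : ℕ) (S C : Matrix (Fin 3) (Fin 3) ℝ) : ℝ :=
  n / 2 * (-Real.log C.det - (S * C⁻¹).trace)

/-- The log-likelihood maximized within model `j`, for the data `x`. The supremum is a genuine one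
when the log-likelihood is bounded above on the model. -/
def maxLogLik (n : ℕ) (j : Fin 2) (x : Fin n → EuclideanSpace ℝ (Fin 3)) : ℝ :=
  sSup (logLik n (sampleCov n x) '' model j)

/-- The log-likelihood ratio statistic contrasting model `0` with model `1`. -/
def lrStat (n : ℕ) (x : Fin n → EuclideanSpace ℝ (Fin 3)) : ℝ :=
  2 * (maxLogLik n 0 x - maxLogLik n 1 x)

end TrivariateGaussian

end

/-!
Each model is a linear structural equation model with three independent errors, so its maximal
likelihood is governed by three least-squares residual variances, and `lrStat` equals
`n * log (covRatio S)`, where `covRatio` depends on the sample covariance `S` only through the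
correlations `r = ρ₁₂`, `s = ρ₁₃`, `t = ρ₂₃`:
`covRatio S = (1 - r²)(1 - s²)(1 - t²) / (1 - r² - s² - t² + 2rst)`.

Near the origin `covRatio S - 1 = s²t² - 2rst` up to smaller terms. Write the true covariance as
`B * Bᵀ` and the sample as `B` applied to white noise whose second-moment matrix is `1 + G / √n`,
with `G` asymptotically normal. Since `s` and `t` tend to zero, `√n s t` tends to `δ`: the factors
are perturbed by `O(n⁻¹ᐟ²)` only. On the other hand `√n r` tends to `c + G₁₂`, where `c` is the
limit of `√n ρ₁₂`. Hence `lrStat` behaves like `δ² - 2δ(c + G₁₂)`, locally uniformly in `G`, and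
tightness of `G` turns this into a statement about distributions. In model `i`, `c = iδ`.
-/

namespace TrivariateGaussian

section Likelihood

open Matrix

/-- The matrix expressing the three coordinates through the independent errors of the linear
structural equations of model `j`, with regression coefficients `α` and `β`: in model `0` the third
coordinate is regressed on the first two, in model `1` the first two are regressed on the third. -/
noncomputable def loading : Fin 2 → ℝ → ℝ → Matrix (Fin 3) (Fin 3) ℝ
  | 0, α, β => !![1, 0, 0; 0, 1, 0; α, β, 1]
  | 1, α, β => !![1, 0, α; 0, 1, β; 0, 0, 1]

/-- The second moment of the `k`-th error of the structural equations of model `j` under the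
covariance `S`. -/
noncomputable def residualVar (j : Fin 2) (S : Matrix (Fin 3) (Fin 3) ℝ) (α β : ℝ)
    (k : Fin 3) : ℝ :=
  (loading j (-α) (-β) * S * (loading j (-α) (-β))ᵀ) k k

lemma det_loading (j : Fin 2) (α β : ℝ) : (loading j α β).det = 1 := by
  fin_cases j <;> simp [loading, det_fin_three]

lemma loading_neg_mul_loading (j : Fin 2) (α β : ℝ) :
    loading j (-α) (-β) * loading j α β = 1 := by
  ext k l
  fin_cases j <;> fin_cases k <;> fin_cases l <;>
    simp [loading, mul_apply, Fin.sum_univ_three]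

lemma loading_mul_loading_neg (j : Fin 2) (α β : ℝ) :
    loading j α β * loading j (-α) (-β) = 1 :=
  mul_eq_one_comm.1 (loading_neg_mul_loading j α β)

lemma posDef_loading_mul_mul_transpose_iff {j : Fin 2} {α β : ℝ}
    {S : Matrix (Fin 3) (Fin 3) ℝ} :
    (loading j α β * S * (loading j α β)ᵀ).PosDef ↔ S.PosDef := by
  have hL : IsUnit (loading j α β) := (isUnit_iff_isUnit_det _).2 (by simp [det_loading])
  simpa [star_eq_conjTranspose] using hL.posDef_star_right_conjugate_iff (x := S)

lemma mul_mul_transpose_apply {R ι κ : Type*} [NonUnitalSemiring R] [Fintype ι]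
    (A : Matrix κ ι R) (S : Matrix ι ι R) (k l : κ) :
    (A * S * Aᵀ) k l = ∑ p, ∑ q, A k p * S p q * A l q := by
  simp only [mul_apply, transpose_apply, Finset.sum_mul]
  exact Finset.sum_comm

lemma apply_comm {ι : Type*} {S : Matrix ι ι ℝ} (hS : S.PosDef) (j k : ι) : S j k = S k j := by
  simpa using hS.isHermitian.apply k j

lemma minor_pos {ι : Type*} {S : Matrix ι ι ℝ} (hS : S.PosDef) {j k : ι} (h : j ≠ k) :
    0 < S j j * S k k - S j k ^ 2 := by
  have hinj : Function.Injective ![j, k] := by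
    intro a b hab
    fin_cases a <;> fin_cases b <;> simp_all
  have hdet := (hS.submatrix hinj).det_pos
  rw [det_fin_two] at hdet
  simpa [apply_comm hS k j, sq] using hdet

lemma eq_diagonal_diag {S : Matrix (Fin 3) (Fin 3) ℝ} (hS : S.PosDef) (h01 : S 0 1 = 0)
    (h02 : S 0 2 = 0) (h12 : S 1 2 = 0) : S = diagonal S.diag := by
  ext k l
  fin_cases k <;> fin_cases l <;> simp [h01, h02, h12, apply_comm hS 1 0, apply_comm hS 2]

lemma posDef_of_mem_model {j : Fin 2} {C : Matrix (Fin 3) (Fin 3) ℝ} (hC : C ∈ model j) :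
    C.PosDef := by
  fin_cases j <;> exact hC.1

lemma exists_eq_loading_mul_diagonal_mul {j : Fin 2} {C : Matrix (Fin 3) (Fin 3) ℝ}
    (hC : C ∈ model j) :
    ∃ α β d, (∀ k, 0 < d k) ∧ C = loading j α β * diagonal d * (loading j α β)ᵀ := by
  have hpd := posDef_of_mem_model hC
  obtain ⟨α, β, h01, h02, h12⟩ : ∃ α β,
      (loading j (-α) (-β) * C * (loading j (-α) (-β))ᵀ) 0 1 = 0 ∧
      (loading j (-α) (-β) * C * (loading j (-α) (-β))ᵀ) 0 2 = 0 ∧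
      (loading j (-α) (-β) * C * (loading j (-α) (-β))ᵀ) 1 2 = 0 := by
    have hne : ∀ k, C k k ≠ 0 := fun k => hpd.diag_pos.ne'
    fin_cases j
    · have h01 : C 0 1 = 0 := hC.2
      refine ⟨C 0 2 / C 0 0, C 1 2 / C 1 1, ?_⟩
      simp only [mul_mul_transpose_apply, Fin.sum_univ_three]
      simp [loading, apply_comm hpd 1 0, h01, mul_div_cancel₀, hne]
    · have h01 : C 0 1 = C 0 2 * C 1 2 / C 2 2 := eq_div_of_mul_eq (hne 2) hC.2
      refine ⟨C 0 2 / C 2 2, C 1 2 / C 2 2, ?_⟩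
      simp only [mul_mul_transpose_apply, Fin.sum_univ_three]
      simp only [loading, of_apply, cons_val, apply_comm hpd 2 1, h01]
      have h2 := hne 2
      refine ⟨?_, ?_, ?_⟩ <;> field_simp <;> ring
  have hM := (posDef_loading_mul_mul_transpose_iff (j := j) (α := -α) (β := -β)).2 hpd
  refine ⟨α, β, diag _, fun k => hM.diag_pos (i := k), ?_⟩
  rw [← eq_diagonal_diag hM h01 h02 h12]
  set L := loading j α β
  set K := loading j (-α) (-β)
  have hLK : L * K = 1 := loading_mul_loading_neg j α β
  calc C = L * K * C * (L * K)ᵀ := by simp [hLK]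
    _ = L * (K * C * Kᵀ) * Lᵀ := by simp only [transpose_mul, Matrix.mul_assoc]

lemma loading_mul_diagonal_mul_mem_model (j : Fin 2) (α β : ℝ) {d : Fin 3 → ℝ}
    (hd : ∀ k, 0 < d k) : loading j α β * diagonal d * (loading j α β)ᵀ ∈ model j := by
  have hpd := (posDef_loading_mul_mul_transpose_iff (j := j) (α := α) (β := β)).2
    (PosDef.diagonal hd)
  fin_cases j
  · exact ⟨hpd, by simp only [mul_mul_transpose_apply, Fin.sum_univ_three]; simp [loading]⟩
  · refine ⟨hpd, ?_⟩
    simp only [mul_mul_transpose_apply, Fin.sum_univ_three, loading, of_apply, cons_val,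
      diagonal_apply, Fin.reduceEq, ↓reduceIte]
    ring

lemma logLik_loading (n : ℕ) (j : Fin 2) (S : Matrix (Fin 3) (Fin 3) ℝ) (α β : ℝ)
    {d : Fin 3 → ℝ} (hd : ∀ k, 0 < d k) :
    logLik n S (loading j α β * diagonal d * (loading j α β)ᵀ) =
      n / 2 * ∑ k, (-Real.log (d k) - residualVar j S α β k / d k) := by
  set L := loading j α β
  set K := loading j (-α) (-β)
  have hKL : K * L = 1 := loading_neg_mul_loading j α β
  have hdet : (L * diagonal d * Lᵀ).det = ∏ k, d k := by
    simp [L, det_mul, det_loading]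
  have hinv : (L * diagonal d * Lᵀ)⁻¹ = Kᵀ * diagonal (fun k => (d k)⁻¹) * K := by
    refine inv_eq_left_inv ?_
    calc Kᵀ * diagonal (fun k => (d k)⁻¹) * K * (L * diagonal d * Lᵀ)
        = Kᵀ * diagonal (fun k => (d k)⁻¹) * (K * L) * diagonal d * Lᵀ := by
          simp only [Matrix.mul_assoc]
      _ = (L * K)ᵀ := by
          rw [hKL, Matrix.mul_one, Matrix.mul_assoc Kᵀ, diagonal_mul_diagonal]
          simp [(hd _).ne', transpose_mul]
      _ = 1 := by rw [mul_eq_one_comm.1 hKL, transpose_one]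
  have htrace : (S * (L * diagonal d * Lᵀ)⁻¹).trace = ∑ k, residualVar j S α β k / d k := by
    rw [hinv, ← Matrix.mul_assoc, trace_mul_comm, ← Matrix.mul_assoc, ← Matrix.mul_assoc]
    simp [trace, mul_diagonal, residualVar, K, div_eq_mul_inv]
  rw [logLik, hdet, htrace, Real.log_prod fun k _ => (hd k).ne', ← Finset.sum_neg_distrib,
    ← Finset.sum_sub_distrib]

lemma neg_log_sub_div_le {s t v : ℝ} (hs : 0 < s) (ht : s ≤ t) (hv : 0 < v) :
    -Real.log v - t / v ≤ -Real.log s - 1 := by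
  have h1 := Real.log_le_sub_one_of_pos (div_pos hs hv)
  rw [Real.log_div hs.ne' hv.ne'] at h1
  have h2 : s / v ≤ t / v := by gcongr
  linarith

lemma isGreatest_logLik_of_residualVar_le (n : ℕ) {j : Fin 2} {S : Matrix (Fin 3) (Fin 3) ℝ}
    (hS : S.PosDef) {α₀ β₀ : ℝ}
    (hmin : ∀ α β k, residualVar j S α₀ β₀ k ≤ residualVar j S α β k) :
    IsGreatest (logLik n S '' model j)
      (n / 2 * (-Real.log (∏ k, residualVar j S α₀ β₀ k) - 3)) := by
  have hpos : ∀ k, 0 < residualVar j S α₀ β₀ k := fun k =>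
    (posDef_loading_mul_mul_transpose_iff.2 hS).diag_pos
  have hsum : -Real.log (∏ k, residualVar j S α₀ β₀ k) - 3 =
      ∑ k, (-Real.log (residualVar j S α₀ β₀ k) - 1) := by
    simp [Real.log_prod fun k _ => (hpos k).ne', Finset.sum_sub_distrib]
  rw [hsum]
  constructor
  · refine ⟨_, loading_mul_diagonal_mul_mem_model j α₀ β₀ hpos, ?_⟩
    rw [logLik_loading n j S α₀ β₀ hpos]
    simp only [div_self (hpos _).ne']
  · rintro _ ⟨C, hC, rfl⟩
    obtain ⟨α, β, d, hd, rfl⟩ := exists_eq_loading_mul_diagonal_mul hC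
    rw [logLik_loading n j S α β hd]
    refine mul_le_mul_of_nonneg_left (Finset.sum_le_sum fun k _ => ?_) (by positivity)
    exact neg_log_sub_div_le (hpos k) (hmin α β k) (hd k)

lemma residualVar_zero (S : Matrix (Fin 3) (Fin 3) ℝ) (hS : S.PosDef) (α β : ℝ) :
    residualVar 0 S α β = ![S 0 0, S 1 1, S 2 2 - 2 * α * S 0 2 - 2 * β * S 1 2
      + α ^ 2 * S 0 0 + 2 * α * β * S 0 1 + β ^ 2 * S 1 1] := by
  ext k
  simp only [residualVar, mul_mul_transpose_apply, Fin.sum_univ_three]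
  fin_cases k <;> simp only [loading, of_apply, cons_val, apply_comm hS 1 0, apply_comm hS 2,
    Fin.reduceFinMk] <;> ring

lemma residualVar_one (S : Matrix (Fin 3) (Fin 3) ℝ) (hS : S.PosDef) (α β : ℝ) :
    residualVar 1 S α β = ![S 0 0 - 2 * α * S 0 2 + α ^ 2 * S 2 2,
      S 1 1 - 2 * β * S 1 2 + β ^ 2 * S 2 2, S 2 2] := by
  ext k
  simp only [residualVar, mul_mul_transpose_apply, Fin.sum_univ_three]
  fin_cases k <;> simp only [loading, of_apply, cons_val, apply_comm hS 2, Fin.reduceFinMk] <;> ring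

lemma det_eq {S : Matrix (Fin 3) (Fin 3) ℝ} (hS : S.PosDef) :
    S.det = S 0 0 * S 1 1 * S 2 2 - S 0 0 * S 1 2 ^ 2 - S 1 1 * S 0 2 ^ 2 - S 2 2 * S 0 1 ^ 2 +
      2 * S 0 1 * S 0 2 * S 1 2 := by
  rw [det_fin_three, apply_comm hS 1 0, apply_comm hS 2 0, apply_comm hS 2 1]
  ring

lemma isGreatest_logLik_model_zero (n : ℕ) {S : Matrix (Fin 3) (Fin 3) ℝ} (hS : S.PosDef) :
    IsGreatest (logLik n S '' model 0)
      (n / 2 * (-Real.log (S 0 0 * S 1 1 * (S.det / (S 0 0 * S 1 1 - S 0 1 ^ 2))) - 3)) := by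
  have h0 : 0 < S 0 0 := hS.diag_pos
  have hm : 0 < S 0 0 * S 1 1 - S 0 1 ^ 2 := minor_pos hS (by decide)
  have hsq (α β : ℝ) : residualVar 0 S α β 2 = S.det / (S 0 0 * S 1 1 - S 0 1 ^ 2) +
      ((S 0 0 * α + S 0 1 * β - S 0 2) ^ 2 +
        ((S 0 0 * S 1 1 - S 0 1 ^ 2) * β - (S 0 0 * S 1 2 - S 0 1 * S 0 2)) ^ 2 /
          (S 0 0 * S 1 1 - S 0 1 ^ 2)) / S 0 0 := by
    rw [residualVar_zero S hS, det_eq hS]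
    simp only [cons_val]
    field_simp
    ring
  set β₀ := (S 0 0 * S 1 2 - S 0 1 * S 0 2) / (S 0 0 * S 1 1 - S 0 1 ^ 2) with hβ₀
  set α₀ := (S 0 2 - S 0 1 * β₀) / S 0 0 with hα₀
  have hval : residualVar 0 S α₀ β₀ 2 = S.det / (S 0 0 * S 1 1 - S 0 1 ^ 2) := by
    rw [hsq, hα₀, mul_div_cancel₀ _ h0.ne', hβ₀, mul_div_cancel₀ _ hm.ne']
    ring
  have hmin (α β : ℝ) (k : Fin 3) : residualVar 0 S α₀ β₀ k ≤ residualVar 0 S α β k := by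
    fin_cases k
    · simp [residualVar_zero S hS]
    · simp [residualVar_zero S hS]
    · exact hval.trans_le (hsq α β ▸ le_add_of_nonneg_right (by positivity))
  convert isGreatest_logLik_of_residualVar_le n hS hmin using 4
  rw [Fin.prod_univ_three, hval, residualVar_zero S hS]
  simp

lemma isGreatest_logLik_model_one (n : ℕ) {S : Matrix (Fin 3) (Fin 3) ℝ} (hS : S.PosDef) :
    IsGreatest (logLik n S '' model 1)
      (n / 2 * (-Real.log ((S 0 0 * S 2 2 - S 0 2 ^ 2) / S 2 2 *
        ((S 1 1 * S 2 2 - S 1 2 ^ 2) / S 2 2) * S 2 2) - 3)) := by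
  have h2 : 0 < S 2 2 := hS.diag_pos
  have hsq (v c x : ℝ) : v - 2 * x * c + x ^ 2 * S 2 2 =
      (v * S 2 2 - c ^ 2) / S 2 2 + S 2 2 * (x - c / S 2 2) ^ 2 := by
    field_simp
    ring
  have hval : residualVar 1 S (S 0 2 / S 2 2) (S 1 2 / S 2 2) =
      ![(S 0 0 * S 2 2 - S 0 2 ^ 2) / S 2 2, (S 1 1 * S 2 2 - S 1 2 ^ 2) / S 2 2, S 2 2] := by
    simp [residualVar_one S hS, hsq]
  have hmin (α β : ℝ) (k : Fin 3) :
      residualVar 1 S (S 0 2 / S 2 2) (S 1 2 / S 2 2) k ≤ residualVar 1 S α β k := by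
    rw [hval, residualVar_one S hS, hsq, hsq]
    fin_cases k <;> simp [mul_nonneg h2.le (sq_nonneg _)]
  convert isGreatest_logLik_of_residualVar_le n hS hmin using 4
  simp [Fin.prod_univ_three, hval]

lemma bddAbove_logLik_image_model (n : ℕ) (j : Fin 2) {S : Matrix (Fin 3) (Fin 3) ℝ}
    (hS : S.PosDef) : BddAbove (logLik n S '' model j) := by
  fin_cases j
  · exact (isGreatest_logLik_model_zero n hS).bddAbove
  · exact (isGreatest_logLik_model_one n hS).bddAbove

/-- The determinant of the correlation matrix with off-diagonal entries `r = ρ₁₂`, `s = ρ₁₃`,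
`t = ρ₂₃`. -/
noncomputable def corrDet (r s t : ℝ) : ℝ := 1 - r ^ 2 - s ^ 2 - t ^ 2 + 2 * r * s * t

/-- The ratio of the maximized likelihoods of model `0` and model `1`, to the power `2 / n`, as a
function of the sample correlations `r = ρ₁₂`, `s = ρ₁₃`, `t = ρ₂₃`. -/
noncomputable def corrRatio (r s t : ℝ) : ℝ :=
  (1 - r ^ 2) * (1 - s ^ 2) * (1 - t ^ 2) / corrDet r s t

/-- The value of `corrRatio` at the correlation coefficients of the covariance matrix `S`. -/
noncomputable def covRatio (S : Matrix (Fin 3) (Fin 3) ℝ) : ℝ :=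
  corrRatio (corr S 0 1) (corr S 0 2) (corr S 1 2)

lemma sqrt_mul_sqrt_mul_corr {S : Matrix (Fin 3) (Fin 3) ℝ} (hS : S.PosDef) (j k : Fin 3) :
    √(S j j) * √(S k k) * corr S j k = S j k := by
  have hj : 0 < S j j := hS.diag_pos
  have hk : 0 < S k k := hS.diag_pos
  rw [corr, Real.sqrt_mul hj.le]
  field_simp

lemma one_sub_corr_sq {S : Matrix (Fin 3) (Fin 3) ℝ} (hS : S.PosDef) (j k : Fin 3) :
    1 - corr S j k ^ 2 = (S j j * S k k - S j k ^ 2) / (S j j * S k k) := by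
  have hj : 0 < S j j := hS.diag_pos
  have hk : 0 < S k k := hS.diag_pos
  rw [corr, div_pow, Real.sq_sqrt (by positivity)]
  field_simp

lemma corrDet_corr {S : Matrix (Fin 3) (Fin 3) ℝ} (hS : S.PosDef) :
    corrDet (corr S 0 1) (corr S 0 2) (corr S 1 2) = S.det / (S 0 0 * S 1 1 * S 2 2) := by
  have hsq (k : Fin 3) : √(S k k) ^ 2 = S k k := Real.sq_sqrt hS.diag_pos.le
  have hne (k : Fin 3) : S k k ≠ 0 := hS.diag_pos.ne'
  rw [eq_div_iff (by simp [hne]), det_eq hS, ← sqrt_mul_sqrt_mul_corr hS 0 1,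
    ← sqrt_mul_sqrt_mul_corr hS 0 2, ← sqrt_mul_sqrt_mul_corr hS 1 2, corrDet]
  simp only [mul_pow, hsq]
  linear_combination -2 * corr S 0 1 * corr S 0 2 * corr S 1 2 *
    (S 1 1 * S 2 2 * hsq 0 + √(S 0 0) ^ 2 * S 2 2 * hsq 1 + √(S 0 0) ^ 2 * √(S 1 1) ^ 2 * hsq 2)

theorem lrStat_eq_mul_log_covRatio {n : ℕ} {x : Fin n → EuclideanSpace ℝ (Fin 3)}
    (hS : (sampleCov n x).PosDef) :
    lrStat n x = n * Real.log (covRatio (sampleCov n x)) := by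
  rw [lrStat, maxLogLik, maxLogLik, (isGreatest_logLik_model_zero n hS).csSup_eq,
    (isGreatest_logLik_model_one n hS).csSup_eq]
  set S := sampleCov n x
  have h0 : 0 < S 0 0 := hS.diag_pos
  have h1 : 0 < S 1 1 := hS.diag_pos
  have h2 : 0 < S 2 2 := hS.diag_pos
  have h01 : 0 < S 0 0 * S 1 1 - S 0 1 ^ 2 := minor_pos hS (by decide)
  have h02 : 0 < S 0 0 * S 2 2 - S 0 2 ^ 2 := minor_pos hS (by decide)
  have h12 : 0 < S 1 1 * S 2 2 - S 1 2 ^ 2 := minor_pos hS (by decide)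
  have hdet := hS.det_pos
  have hratio : covRatio S =
      (S 0 0 * S 2 2 - S 0 2 ^ 2) / S 2 2 * ((S 1 1 * S 2 2 - S 1 2 ^ 2) / S 2 2) * S 2 2 /
        (S 0 0 * S 1 1 * (S.det / (S 0 0 * S 1 1 - S 0 1 ^ 2))) := by
    rw [covRatio, corrRatio, corrDet_corr hS]
    simp only [one_sub_corr_sq hS]
    field_simp
  rw [hratio, Real.log_div (by positivity) (by positivity)]
  ring

end Likelihood

section Measurability

open Matrix

lemma sSup_eq_sSup_of_subset_closure {s t : Set ℝ} (hts : t ⊆ s) (hst : s ⊆ closure t) :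
    sSup s = sSup t := by
  rcases t.eq_empty_or_nonempty with rfl | hne
  · simp_all
  by_cases hb : BddAbove t
  · have hlub := (isLUB_iff_of_subset_of_subset_closure hts hst).1 (isLUB_csSup hne hb)
    exact hlub.csSup_eq (hne.mono hts)
  · rw [Real.sSup_of_not_bddAbove hb, Real.sSup_of_not_bddAbove fun h => hb (h.mono hts)]

lemma measurable_sSup_image {Ω X : Type*} [MeasurableSpace Ω] [TopologicalSpace X]
    [TopologicalSpace.PseudoMetrizableSpace X] [TopologicalSpace.SeparableSpace X]
    {f : Ω → X → ℝ} {s : Set X} (hcont : ∀ ω, ContinuousOn (f ω) s)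
    (hmeas : ∀ x, Measurable fun ω => f ω x) : Measurable fun ω => sSup (f ω '' s) := by
  obtain ⟨t, hts, htc, hst⟩ :=
    (TopologicalSpace.IsSeparable.of_separableSpace s).exists_countable_dense_subset
  have hdense (ω : Ω) : f ω '' s ⊆ closure (f ω '' t) := by
    rintro _ ⟨x, hx, rfl⟩
    exact ((hcont ω x hx).mono hts).mem_closure_image (hst hx)
  simp only [fun ω => sSup_eq_sSup_of_subset_closure (Set.image_mono hts) (hdense ω)]
  exact Measurable.sSup htc fun x _ => hmeas x

lemma continuousOn_logLik (n : ℕ) (S : Matrix (Fin 3) (Fin 3) ℝ) :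
    ContinuousOn (logLik n S) {C | C.PosDef} := by
  intro C hC
  have hdet : C.det ≠ 0 := (Matrix.PosDef.det_pos hC).ne'
  have hinv : ContinuousAt (fun C : Matrix (Fin 3) (Fin 3) ℝ => C⁻¹) C :=
    continuousAt_matrix_inv C (Ring.inverse_eq_inv' (G₀ := ℝ) ▸ continuousAt_inv₀ hdet)
  have hlog : ContinuousAt (fun C : Matrix (Fin 3) (Fin 3) ℝ => Real.log C.det) C :=
    continuous_id.matrix_det.continuousAt.log hdet
  have htrace : ContinuousAt (fun C : Matrix (Fin 3) (Fin 3) ℝ => (S * C⁻¹).trace) C :=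
    (continuous_const.matrix_mul continuous_id).matrix_trace.continuousAt.comp hinv
  exact (continuousAt_const.mul (hlog.neg.sub htrace)).continuousWithinAt

lemma measurable_sampleCov_apply (n : ℕ) (j k : Fin 3) :
    Measurable fun x : Fin n → EuclideanSpace ℝ (Fin 3) => sampleCov n x j k := by
  simp only [sampleCov, Matrix.of_apply]
  fun_prop

lemma measurable_logLik_sampleCov (n : ℕ) (C : Matrix (Fin 3) (Fin 3) ℝ) :
    Measurable fun x : Fin n → EuclideanSpace ℝ (Fin 3) => logLik n (sampleCov n x) C := by
  have := measurable_sampleCov_apply n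
  simp only [logLik, Matrix.trace, Matrix.diag, Matrix.mul_apply]
  fun_prop

lemma measurable_maxLogLik (n : ℕ) (j : Fin 2) : Measurable (maxLogLik n j) :=
  have : TopologicalSpace.SeparableSpace (Matrix (Fin 3) (Fin 3) ℝ) :=
    inferInstanceAs (TopologicalSpace.SeparableSpace (Fin 3 → Fin 3 → ℝ))
  have : TopologicalSpace.PseudoMetrizableSpace (Matrix (Fin 3) (Fin 3) ℝ) :=
    inferInstanceAs (TopologicalSpace.PseudoMetrizableSpace (Fin 3 → Fin 3 → ℝ))
  measurable_sSup_image
    (fun _ => (continuousOn_logLik n _).mono fun _ hC => posDef_of_mem_model hC)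
    (measurable_logLik_sampleCov n)

lemma measurable_lrStat (n : ℕ) : Measurable (lrStat n) :=
  ((measurable_maxLogLik n 0).sub (measurable_maxLogLik n 1)).const_mul 2

end Measurability

section Nondegeneracy

open Matrix

lemma ae_linearIndependent_pi {E : Type*} [NormedAddCommGroup E] [NormedSpace ℝ E]
    [FiniteDimensional ℝ E] [MeasurableSpace E] [BorelSpace E] {μ : Measure E} [SigmaFinite μ]
    (hμ : ∀ p : Submodule ℝ E, p ≠ ⊤ → μ p = 0) {k : ℕ} (hk : k ≤ Module.finrank ℝ E) :
    ∀ᵐ x ∂Measure.pi fun _ : Fin k => μ, LinearIndependent ℝ x := by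
  induction k with
  | zero => exact Eventually.of_forall fun x => linearIndependent_empty_type
  | succ k ih =>
    have hcons : Measurable fun z : E × (Fin k → E) => (Fin.cons z.1 z.2 : Fin (k + 1) → E) :=
      measurable_pi_iff.2 <| Fin.cases measurable_fst fun j =>
        (measurable_pi_apply j).comp measurable_snd
    have hmeas : MeasurableSet
        {z : E × (Fin k → E) | LinearIndependent ℝ (Fin.cons z.1 z.2 : Fin (k + 1) → E)} :=
      hcons isOpen_setOfPred_linearIndependent.measurableSet
    have hprod : ∀ᵐ z ∂μ.prod (Measure.pi fun _ : Fin k => μ),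
        LinearIndependent ℝ (Fin.cons z.1 z.2 : Fin (k + 1) → E) := by
      rw [Measure.ae_prod_iff_ae_ae hmeas, Measure.ae_ae_comm hmeas]
      filter_upwards [ih (by omega)] with x hx
      have hspan : Submodule.span ℝ (Set.range x) ≠ ⊤ := by
        intro htop
        have := finrank_span_eq_card hx
        rw [htop, finrank_top, Fintype.card_fin] at this
        omega
      filter_upwards [measure_eq_zero_iff_ae_notMem.1 (hμ _ hspan)] with y hy
      exact linearIndependent_finCons.2 ⟨hx, hy⟩
    filter_upwards [(measurePreserving_piFinSuccAbove (fun _ => μ) 0).quasiMeasurePreserving.ae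
      hprod] with x hx
    simpa [MeasurableEquiv.piFinSuccAbove, Fin.insertNthEquiv] using hx

lemma measurePreserving_comp_of_injective {ι κ E : Type*} [Fintype ι] [Fintype κ]
    [MeasurableSpace E] (μ : Measure E) [IsProbabilityMeasure μ] {f : κ → ι}
    (hf : Function.Injective f) :
    MeasurePreserving (fun x : ι → E => x ∘ f) (Measure.pi fun _ => μ)
      (Measure.pi fun _ => μ) := by
  refine ⟨by fun_prop, ?_⟩
  rw [← Measure.infinitePi_eq_pi, ← Measure.infinitePi_eq_pi]
  exact Measure.map_infinitePi_infinitePi_of_inj hf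

lemma ae_inner_ne_zero {ι : Type*} [Fintype ι] [DecidableEq ι] {C : Matrix ι ι ℝ}
    (hC : C.PosDef) {v : EuclideanSpace ℝ ι} (hv : v ≠ 0) :
    ∀ᵐ x ∂multivariateGaussian 0 C, inner ℝ v x ≠ 0 := by
  have hvar : Var[(innerSL ℝ v : EuclideanSpace ℝ ι → ℝ); multivariateGaussian 0 C] =
      v.ofLp ⬝ᵥ C *ᵥ v.ofLp := by
    rw [← covarianceBilin_multivariateGaussian hC.posSemidef,
      covarianceBilin_self IsGaussian.memLp_two_id]
    rfl
  have hpos : 0 < v.ofLp ⬝ᵥ C *ᵥ v.ofLp := by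
    simpa using hC.dotProduct_mulVec_pos (x := v.ofLp) (by simpa using hv)
  have hmap := IsGaussian.map_eq_gaussianReal (μ := multivariateGaussian 0 C) (innerSL ℝ v)
  rw [hvar] at hmap
  have hatom := nullSingletonClass_gaussianReal (μ := (multivariateGaussian 0 C)[innerSL ℝ v])
    (v := (v.ofLp ⬝ᵥ C *ᵥ v.ofLp).toNNReal) (by simpa using hpos)
  rw [← hmap] at hatom
  exact ae_of_ae_map (f := innerSL ℝ v) (p := (· ≠ 0)) (by fun_prop)
    (measure_eq_zero_iff_ae_notMem.1 (measure_singleton 0))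

lemma multivariateGaussian_submodule {ι : Type*} [Fintype ι] [DecidableEq ι] {C : Matrix ι ι ℝ}
    (hC : C.PosDef) {p : Submodule ℝ (EuclideanSpace ℝ ι)} (hp : p ≠ ⊤) :
    multivariateGaussian 0 C p = 0 := by
  obtain ⟨v, hvp, hv⟩ := pᗮ.exists_mem_ne_zero_of_ne_bot (by simpa using hp)
  rw [measure_eq_zero_iff_ae_notMem]
  filter_upwards [ae_inner_ne_zero hC hv] with x hx hxp
  exact hx (p.inner_left_of_mem_orthogonal hxp hvp)

lemma sampleCov_eq_smul_conjTranspose_mul (n : ℕ) (x : Fin n → EuclideanSpace ℝ (Fin 3)) :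
    sampleCov n x = (n : ℝ)⁻¹ • ((of fun m j => x m j)ᴴ * of fun m j => x m j) := by
  ext j k
  simp [sampleCov, mul_apply, div_eq_inv_mul]

lemma posDef_sampleCov_of_linearIndependent {n : ℕ} {x : Fin n → EuclideanSpace ℝ (Fin 3)}
    {f : Fin 3 → Fin n} (h : LinearIndependent ℝ (x ∘ f)) : (sampleCov n x).PosDef := by
  have hn : 0 < n := (f 0).pos
  have hrows : LinearIndependent ℝ (of fun a j => x (f a) j : Matrix (Fin 3) (Fin 3) ℝ).row :=
    h.map' (WithLp.linearEquiv 2 ℝ (Fin 3 → ℝ)).toLinearMap (LinearEquiv.ker _)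
  rw [sampleCov_eq_smul_conjTranspose_mul]
  refine (PosDef.conjTranspose_mul_self _ fun v w hvw => ?_).smul (by positivity)
  refine mulVec_injective_of_isUnit (linearIndependent_rows_iff_isUnit.1 hrows) ?_
  exact funext fun a => congrFun hvw (f a)

lemma ae_posDef_sampleCov {n : ℕ} (hn : 3 ≤ n) {C : Matrix (Fin 3) (Fin 3) ℝ} (hC : C.PosDef) :
    ∀ᵐ x ∂sampleLaw n C, (sampleCov n x).PosDef := by
  have hlin := ae_linearIndependent_pi (k := 3) (fun p hp => multivariateGaussian_submodule hC hp)
    (by simp)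
  filter_upwards [(measurePreserving_comp_of_injective (multivariateGaussian 0 C)
    (Fin.castLE_injective hn)).quasiMeasurePreserving.ae hlin] with x hx
  exact posDef_sampleCov_of_linearIndependent hx

end Nondegeneracy

section Expansion

variable {α : Type*} {l : Filter α}

lemma tendsto_mul_log_of_tendsto_mul_sub_one {N w : α → ℝ} {a : ℝ} (hN : Tendsto N l atTop)
    (h : Tendsto (fun x => N x * (w x - 1)) l (𝓝 a)) :
    Tendsto (fun x => N x * Real.log (w x)) l (𝓝 a) := by
  have hw : Tendsto w l (𝓝 1) := by
    refine (((h.div_atTop hN).add_const 1).congr' ?_).trans_eq (by rw [zero_add])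
    filter_upwards [hN.eventually_ne_atTop 0] with x hx
    rw [mul_div_cancel_left₀ _ hx, sub_add_cancel]
  have hlog : DifferentiableAt ℝ Real.log 1 := Real.differentiableAt_log one_ne_zero
  have hslope : Tendsto (fun x => dslope Real.log 1 (w x)) l (𝓝 1) := by
    simpa [dslope_same, Function.comp_def] using
      (continuousAt_dslope_same.2 hlog).tendsto.comp hw
  have hmul (x : α) : N x * (w x - 1) * dslope Real.log 1 (w x) = N x * Real.log (w x) := by
    simpa [mul_assoc] using congrArg (N x * ·) (sub_smul_dslope Real.log 1 (w x))
  simpa [hmul] using h.mul hslope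

lemma tendsto_zero_of_tendsto_sqrt_mul {N r : α → ℝ} {u : ℝ} (hN : Tendsto N l atTop)
    (hr : Tendsto (fun x => √(N x) * r x) l (𝓝 u)) : Tendsto r l (𝓝 0) := by
  refine (hr.div_atTop (Real.tendsto_sqrt_atTop.comp hN)).congr' ?_
  filter_upwards [hN.eventually_gt_atTop 0] with x hx
  exact mul_div_cancel_left₀ _ (Real.sqrt_pos.2 hx).ne'

lemma tendsto_mul_log_corrRatio {N r s t : α → ℝ} {u δ : ℝ} (hN : Tendsto N l atTop)
    (hr : Tendsto (fun x => √(N x) * r x) l (𝓝 u)) (hs : Tendsto s l (𝓝 0))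
    (ht : Tendsto t l (𝓝 0)) (hst : Tendsto (fun x => √(N x) * (s x * t x)) l (𝓝 δ)) :
    Tendsto (fun x => N x * Real.log (corrRatio (r x) (s x) (t x))) l
      (𝓝 (δ ^ 2 - 2 * δ * u)) := by
  have hr0 : Tendsto r l (𝓝 0) := tendsto_zero_of_tendsto_sqrt_mul hN hr
  have hD : Tendsto (fun x => corrDet (r x) (s x) (t x)) l (𝓝 1) := by
    have h := ((((hr0.pow 2).const_sub 1).sub (hs.pow 2)).sub (ht.pow 2)).add
      (((hr0.const_mul 2).mul hs).mul ht)
    simpa [corrDet] using h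
  have hnum := (((hr.pow 2).mul (((hs.pow 2).add (ht.pow 2)).sub ((hs.pow 2).mul (ht.pow 2)))).add
    (hst.pow 2)).sub ((hr.const_mul 2).mul hst)
  refine tendsto_mul_log_of_tendsto_mul_sub_one hN
    (((hnum.div hD one_ne_zero).congr' ?_).trans_eq (by congr 1; ring))
  filter_upwards [hN.eventually_ge_atTop 0, hD.eventually_ne one_ne_zero] with x hx hDx
  have hsq := Real.sq_sqrt hx
  rw [corrRatio, div_sub_one hDx, Pi.div_apply, mul_div_assoc', div_left_inj' hDx, corrDet]
  linear_combination ((r x) ^ 2 * (s x ^ 2 + t x ^ 2 - s x ^ 2 * t x ^ 2) + (s x * t x) ^ 2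
    - 2 * r x * (s x * t x)) * hsq

lemma tendsto_mul_log_covRatio {N : α → ℝ} {S : α → Matrix (Fin 3) (Fin 3) ℝ} {u δ : ℝ}
    (hN : Tendsto N l atTop) (hS : Tendsto S l (𝓝 1))
    (h01 : Tendsto (fun x => √(N x) * S x 0 1) l (𝓝 u))
    (hprod : Tendsto (fun x => √(N x) * (S x 0 2 * S x 1 2)) l (𝓝 δ)) :
    Tendsto (fun x => N x * Real.log (covRatio (S x))) l (𝓝 (δ ^ 2 - 2 * δ * u)) := by
  have hentry (j k : Fin 3) : Tendsto (fun x => S x j k) l (𝓝 ((1 : Matrix _ _ ℝ) j k)) :=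
    (hS.apply_nhds j).apply_nhds k
  have hscale (j k : Fin 3) : Tendsto (fun x => √(S x j j * S x k k)) l (𝓝 1) := by
    simpa using ((hentry j j).mul (hentry k k)).sqrt
  have hcorr {j k : Fin 3} (hjk : j ≠ k) : Tendsto (fun x => corr (S x) j k) l (𝓝 0) := by
    simpa [hjk, corr, Pi.div_def] using (hentry j k).div (hscale j k) one_ne_zero
  refine tendsto_mul_log_corrRatio hN ?_ (hcorr (by decide)) (hcorr (by decide)) ?_
  · simpa only [corr, Pi.div_def, mul_div_assoc, div_one] using h01.div (hscale 0 1) one_ne_zero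
  · simpa only [corr, Pi.div_def, mul_div_assoc, div_mul_div_comm, mul_one, div_one] using
      hprod.div ((hscale 0 2).mul (hscale 1 2)) (by simp)

lemma tendsto_mul_log_covRatio_add {N : α → ℝ} {R K : α → Matrix (Fin 3) (Fin 3) ℝ}
    {K₀ : Matrix (Fin 3) (Fin 3) ℝ} {c δ : ℝ} (hN : Tendsto N l atTop) (hR : Tendsto R l (𝓝 1))
    (h01 : Tendsto (fun x => √(N x) * R x 0 1) l (𝓝 c))
    (hprod : Tendsto (fun x => √(N x) * (R x 0 2 * R x 1 2)) l (𝓝 δ)) (hK : Tendsto K l (𝓝 K₀)) :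
    Tendsto (fun x => N x * Real.log (covRatio (R x + (√(N x))⁻¹ • K x))) l
      (𝓝 (δ ^ 2 - 2 * δ * (c + K₀ 0 1))) := by
  have hinv : Tendsto (fun x => (√(N x))⁻¹) l (𝓝 0) :=
    (Real.tendsto_sqrt_atTop.comp hN).inv_tendsto_atTop
  have hne : ∀ᶠ x in l, √(N x) ≠ 0 :=
    (Real.tendsto_sqrt_atTop.comp hN).eventually_ne_atTop 0
  have hRentry (j k : Fin 3) : Tendsto (fun x => R x j k) l (𝓝 ((1 : Matrix _ _ ℝ) j k)) :=
    (hR.apply_nhds j).apply_nhds k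
  have hKentry (j k : Fin 3) : Tendsto (fun x => K x j k) l (𝓝 (K₀ j k)) :=
    (hK.apply_nhds j).apply_nhds k
  refine tendsto_mul_log_covRatio hN ?_ ?_ ?_
  · simpa using hR.add (hinv.smul hK)
  · refine (h01.add (hKentry 0 1)).congr' ?_
    filter_upwards [hne] with x hx
    simp [mul_add, hx]
  · have h := ((hprod.add ((hRentry 0 2).mul (hKentry 1 2))).add
      ((hKentry 0 2).mul (hRentry 1 2))).add (hinv.mul ((hKentry 0 2).mul (hKentry 1 2)))
    refine (h.congr' ?_).trans_eq (by simp)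
    filter_upwards [hne] with x hx
    simp only [Matrix.add_apply, Matrix.smul_apply, smul_eq_mul]
    field_simp
    ring

end Expansion

section Perturbation

open Matrix

lemma tendstoLocallyUniformly_mul_log_covRatio {A : ℕ → Matrix (Fin 3) (Fin 3) ℝ} {c δ : ℝ}
    (hA : Tendsto A atTop (𝓝 1))
    (h01 : Tendsto (fun n : ℕ => √n * (A n * (A n)ᵀ) 0 1) atTop (𝓝 c))
    (hprod : Tendsto (fun n : ℕ => √n * ((A n * (A n)ᵀ) 0 2 * (A n * (A n)ᵀ) 1 2)) atTop
      (𝓝 δ)) :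
    TendstoLocallyUniformly
      (fun (n : ℕ) G => n * Real.log (covRatio (A n * (1 + (√n)⁻¹ • G) * (A n)ᵀ)))
      (fun G => δ ^ 2 - 2 * δ * (c + G 0 1)) atTop := by
  refine tendstoLocallyUniformly_iff_forall_tendsto.2 fun G₀ => ?_
  have hfst : Tendsto Prod.fst ((atTop : Filter ℕ) ×ˢ 𝓝 G₀) atTop := tendsto_fst
  have hAT : Tendsto (fun n => (A n)ᵀ) atTop (𝓝 1) := by
    simpa [Function.comp_def] using (continuous_id.matrix_transpose.tendsto _).comp hA
  have hR : Tendsto (fun n => A n * (A n)ᵀ) atTop (𝓝 1) := by simpa using hA.mul hAT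
  have hK : Tendsto (fun y : ℕ × Matrix (Fin 3) (Fin 3) ℝ => A y.1 * y.2 * (A y.1)ᵀ)
      (atTop ×ˢ 𝓝 G₀) (𝓝 G₀) := by
    simpa using ((hA.comp hfst).mul tendsto_snd).mul (hAT.comp hfst)
  have hF := tendsto_mul_log_covRatio_add (tendsto_natCast_atTop_atTop.comp hfst)
    (hR.comp hfst) (h01.comp hfst) (hprod.comp hfst) hK
  have hlim : Tendsto (fun y : ℕ × Matrix (Fin 3) (Fin 3) ℝ => δ ^ 2 - 2 * δ * (c + y.2 0 1))
      (atTop ×ˢ 𝓝 G₀) (𝓝 (δ ^ 2 - 2 * δ * (c + G₀ 0 1))) :=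
    ((((tendsto_snd.apply_nhds 0).apply_nhds 1).const_add c).const_mul (2 * δ)).const_sub (δ ^ 2)
  have hmat (n : ℕ) (G : Matrix (Fin 3) (Fin 3) ℝ) : A n * (1 + (√n)⁻¹ • G) * (A n)ᵀ =
      A n * (A n)ᵀ + (√n)⁻¹ • (A n * G * (A n)ᵀ) := by
    simp only [Matrix.mul_add, Matrix.add_mul, Matrix.mul_one, Matrix.mul_smul, Matrix.smul_mul]
  simp only [hmat]
  exact (hlim.prodMk_nhds hF).mono_right (nhds_le_uniformity _)

end Perturbation

section Tightness

variable {ι Ω E : Type*} {mΩ : MeasurableSpace Ω} {P : Measure Ω}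

/-- Tightness of a family of random elements of a topological space: up to an arbitrarily small
probability, all of them take values in a common compact set. Unlike `IsTightMeasureSet` applied to
the laws, it requires no measurable structure on the target space. -/
def IsTightFamily [TopologicalSpace E] (P : Measure Ω) (X : ι → Ω → E) : Prop :=
  ∀ ε > 0, ∃ K, IsCompact K ∧ ∀ i, P {ω | X i ω ∉ K} ≤ ε

lemma IsTightFamily.pi {κ : Type*} [Countable κ] {E : κ → Type*} [∀ k, TopologicalSpace (E k)]
    {X : ι → Ω → ∀ k, E k} (h : ∀ k, IsTightFamily P fun i ω => X i ω k) :
    IsTightFamily P X := by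
  intro ε hε
  obtain ⟨η, hη, hsum⟩ := ENNReal.exists_pos_sum_of_countable' hε.ne' κ
  choose K hK hPK using fun k => h k (η k) (hη k)
  refine ⟨Set.univ.pi K, isCompact_univ_pi hK, fun i => ?_⟩
  calc P {ω | X i ω ∉ Set.univ.pi K}
      = P (⋃ k, {ω | X i ω k ∉ K k}) := by congr 1; ext ω; simp
    _ ≤ ∑' k, P {ω | X i ω k ∉ K k} := measure_iUnion_le _
    _ ≤ ∑' k, η k := ENNReal.tsum_le_tsum fun k => hPK k i
    _ ≤ ε := hsum.le

lemma isTightFamily_of_tendstoInDistribution [PseudoMetricSpace E] [CompleteSpace E]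
    [SecondCountableTopology E] [MeasurableSpace E] [BorelSpace E] [IsProbabilityMeasure P]
    {Ω' : Type*} {mΩ' : MeasurableSpace Ω'} {P' : Measure Ω'} [IsProbabilityMeasure P']
    {X : ℕ → Ω → E} {Z : Ω' → E} (h : TendstoInDistribution X atTop Z (fun _ => P) P') :
    IsTightFamily P X := by
  have hcompact := h.tendsto.isCompact_insert_range.closure_of_subset (Set.subset_insert _ _)
  intro ε hε
  obtain ⟨K, hK, hPK⟩ := isTightMeasureSet_iff_exists_isCompact_measure_compl_le.1
    (isTightMeasureSet_of_isCompact_closure hcompact) ε hε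
  refine ⟨closure K, hK.closure, fun n => ?_⟩
  have hle := (measure_mono (Set.compl_subset_compl.2 subset_closure)).trans
    (hPK _ ⟨_, ⟨n, rfl⟩, rfl⟩)
  rwa [ProbabilityMeasure.coe_mk, Measure.map_apply_of_aemeasurable (h.forall_aemeasurable n)
    isClosed_closure.measurableSet.compl] at hle

lemma IsTightFamily.tendstoInMeasure_sub [TopologicalSpace E] {E' : Type*}
    [SeminormedAddCommGroup E'] {X : ι → Ω → E} {l : Filter ι} {F : ι → E → E'} {f : E → E'}
    (hX : IsTightFamily P X) (hF : TendstoLocallyUniformly F f l) :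
    TendstoInMeasure P (fun i ω => F i (X i ω) - f (X i ω)) l 0 := by
  refine tendstoInMeasure_iff_norm.2 fun ε hε => ENNReal.tendsto_nhds_zero.2 fun η hη => ?_
  obtain ⟨K, hK, hPK⟩ := hX η hη
  have hunif := (tendstoLocallyUniformlyOn_iff_tendstoUniformlyOn_of_compact hK).1
    hF.tendstoLocallyUniformlyOn
  filter_upwards [Metric.tendstoUniformlyOn_iff.1 hunif ε hε] with i hi
  refine (measure_mono fun ω hω hmem => ?_).trans (hPK i)
  simp only [Set.mem_ofPred_eq, Pi.zero_apply, sub_zero, ← dist_eq_norm] at hω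
  exact (hω.trans_lt (dist_comm (f (X i ω)) _ ▸ hi _ hmem)).false

end Tightness

section Noise

variable {ι : Type*} [Fintype ι]

/-- The law of a vector of independent standard normal variables. -/
noncomputable abbrev stdNormalLaw (ι : Type*) [Fintype ι] : Measure (ι → ℝ) :=
  Measure.pi fun _ => gaussianReal 0 1

/-- The law of an infinite sequence of independent standard normal vectors. It carries the samples
of all sizes at once, whatever their covariances. -/
noncomputable abbrev noiseLaw (ι : Type*) [Fintype ι] : Measure (ℕ → ι → ℝ) :=
  Measure.infinitePi fun _ => stdNormalLaw ι

/-- The normalized fluctuation `√n (S - 1)` of the second-moment matrix `S` of the first `n` noise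
vectors. -/
noncomputable def fluct [DecidableEq ι] (n : ℕ) (ω : ℕ → ι → ℝ) : Matrix ι ι ℝ :=
  .of fun j k => (√n)⁻¹ * (∑ m ∈ Finset.range n, ω m j * ω m k - n * (1 : Matrix ι ι ℝ) j k)

lemma integral_sq_gaussianReal (v : NNReal) : ∫ x, x ^ 2 ∂gaussianReal 0 v = v := by
  rw [← variance_fun_id_gaussianReal (μ := 0) (v := v)]
  exact (variance_of_integral_eq_zero aemeasurable_id (by simp)).symm

lemma memLp_eval_stdNormalLaw (j : ι) (p : NNReal) :
    MemLp (fun z : ι → ℝ => z j) p (stdNormalLaw ι) :=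
  (memLp_id_gaussianReal p).comp_measurePreserving (measurePreserving_eval _ j)

lemma memLp_eval_mul_eval_stdNormalLaw (j k : ι) :
    MemLp (fun z : ι → ℝ => z j * z k) 2 (stdNormalLaw ι) := by
  have : ENNReal.HolderTriple ((4 : NNReal) : ENNReal) ((4 : NNReal) : ENNReal) 2 := by
    constructor
    rw [show ((4 : NNReal) : ENNReal) = 2 * 2 by norm_num,
      ENNReal.mul_inv (by simp) (by simp), ← mul_add, ENNReal.inv_two_add_inv_two, mul_one]
  exact (memLp_eval_stdNormalLaw k 4).mul (memLp_eval_stdNormalLaw j 4)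

lemma integral_comp_eval_stdNormalLaw (j : ι) {f : ℝ → ℝ} (hf : Measurable f) :
    ∫ z, f (z j) ∂stdNormalLaw ι = ∫ x, f x ∂gaussianReal 0 1 :=
  integral_comp_eval (X := fun _ : ι => ℝ) (μ := fun _ => gaussianReal 0 1)
    hf.aestronglyMeasurable

lemma integral_comp_eval_mul_comp_eval_stdNormalLaw {j k : ι} (h : j ≠ k) {f g : ℝ → ℝ}
    (hf : Measurable f) (hg : Measurable g) :
    ∫ z, f (z j) * g (z k) ∂stdNormalLaw ι =
      (∫ x, f x ∂gaussianReal 0 1) * ∫ x, g x ∂gaussianReal 0 1 := by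
  have hind : IndepFun (fun z : ι → ℝ => z j) (fun z => z k) (stdNormalLaw ι) :=
    (iIndepFun_pi (X := fun _ (y : ℝ) => y) fun _ => aemeasurable_id).indepFun h
  rw [hind.integral_fun_comp_mul_comp (measurable_pi_apply j).aemeasurable
    (measurable_pi_apply k).aemeasurable hf.aestronglyMeasurable hg.aestronglyMeasurable,
    integral_comp_eval_stdNormalLaw j hf, integral_comp_eval_stdNormalLaw k hg]

lemma integral_eval_mul_eval_stdNormalLaw [DecidableEq ι] (j k : ι) :
    ∫ z, z j * z k ∂stdNormalLaw ι = (1 : Matrix ι ι ℝ) j k := by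
  obtain rfl | h := eq_or_ne j k
  · simp only [← sq, Matrix.one_apply_eq]
    rw [integral_comp_eval_stdNormalLaw j (f := (· ^ 2)) (by fun_prop), integral_sq_gaussianReal,
      NNReal.coe_one]
  · rw [integral_comp_eval_mul_comp_eval_stdNormalLaw h measurable_id' measurable_id']
    simp [h]

lemma variance_eval_mul_eval_stdNormalLaw {j k : ι} (h : j ≠ k) :
    Var[fun z => z j * z k; stdNormalLaw ι] = 1 := by
  classical
  have hsq : ∫ z, (z j * z k) ^ 2 ∂stdNormalLaw ι = 1 := by
    simp only [mul_pow]
    rw [integral_comp_eval_mul_comp_eval_stdNormalLaw (f := (· ^ 2)) (g := (· ^ 2)) h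
      (by fun_prop) (by fun_prop), integral_sq_gaussianReal, NNReal.coe_one, mul_one]
  have hmean : ∫ z, z j * z k ∂stdNormalLaw ι = 0 := by
    rw [integral_eval_mul_eval_stdNormalLaw, Matrix.one_apply_ne h]
  rw [variance_of_integral_eq_zero (memLp_eval_mul_eval_stdNormalLaw j k).aemeasurable hmean, hsq]

lemma tendstoInDistribution_fluct_apply [DecidableEq ι] (j k : ι) {Ω : Type*}
    [MeasurableSpace Ω] {P : Measure Ω} [IsProbabilityMeasure P] {Y : Ω → ℝ}
    (hY : HasLaw Y (gaussianReal 0 Var[fun z => z j * z k; stdNormalLaw ι].toNNReal) P) :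
    TendstoInDistribution (fun n ω => fluct n ω j k) atTop Y (fun _ => noiseLaw ι) P := by
  have hprod : Measurable fun z : ι → ℝ => z j * z k := by fun_prop
  have hident (m : ℕ) : IdentDistrib (fun ω : ℕ → ι → ℝ => ω m j * ω m k) (fun z => z j * z k)
      (noiseLaw ι) (stdNormalLaw ι) :=
    ⟨by fun_prop, hprod.aemeasurable, by
      rw [← (measurePreserving_eval_infinitePi (fun _ : ℕ => stdNormalLaw ι) m).map_eq,
        Measure.map_map hprod (by fun_prop)]; rfl⟩
  have h := tendstoInDistribution_inv_sqrt_mul_sum_sub (P := noiseLaw ι) (P' := P) (Y := Y)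
    (X := fun m ω => ω m j * ω m k) (by rwa [(hident 0).variance_eq])
    ((hident 0).memLp_iff.2 (memLp_eval_mul_eval_stdNormalLaw j k))
    (iIndepFun_infinitePi (X := fun _ (z : ι → ℝ) => z j * z k) fun _ => hprod)
    fun m => (hident m).trans (hident 0).symm
  simpa only [fluct, Matrix.of_apply, (hident 0).integral_eq,
    integral_eval_mul_eval_stdNormalLaw] using h

lemma isTightFamily_fluct [DecidableEq ι] : IsTightFamily (noiseLaw ι) fluct :=
  .pi fun j => .pi fun k => isTightFamily_of_tendstoInDistribution
    (tendstoInDistribution_fluct_apply j k HasLaw.id)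

end Noise

section Coupling

open Matrix

variable {ι : Type*} [Fintype ι] [DecidableEq ι]

/-- The sample of size `n` obtained from the noise `ω` by the linear map `B`; its distribution is
that of `n` independent centred Gaussian vectors with covariance `B * Bᵀ`. -/
noncomputable def linearSample (n : ℕ) (B : Matrix ι ι ℝ) (ω : ℕ → ι → ℝ) :
    Fin n → EuclideanSpace ℝ ι :=
  fun m => WithLp.toLp 2 (B *ᵥ ω m)

lemma stdGaussian_map_toEuclideanCLM (B : Matrix ι ι ℝ) :
    (stdGaussian (EuclideanSpace ℝ ι)).map (toEuclideanCLM (𝕜 := ℝ) B) =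
      multivariateGaussian 0 (B * Bᵀ) := by
  have hpsd : (B * Bᵀ).PosSemidef := by simpa using posSemidef_self_mul_conjTranspose B
  have hadj : (toEuclideanCLM (𝕜 := ℝ) B).adjoint = toEuclideanCLM (𝕜 := ℝ) Bᵀ := by
    rw [← ContinuousLinearMap.star_eq_adjoint, ← map_star, star_eq_conjTranspose,
      conjTranspose_eq_transpose_of_trivial]
  refine IsGaussian.ext ?_ ?_
  · simp only [id_eq]
    rw [ContinuousLinearMap.integral_id_map IsGaussian.integrable_id, integral_id_stdGaussian,
      map_zero, integral_id_multivariateGaussian]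
  · ext u v
    rw [covarianceBilin_map IsGaussian.memLp_two_id, covarianceBilin_stdGaussian,
      innerSL_apply_apply, ContinuousLinearMap.adjoint_inner_left, hadj, inner_toEuclideanCLM,
      ofLp_toEuclideanCLM, covarianceBilin_multivariateGaussian hpsd, mulVec_mulVec]

lemma measurePreserving_toLp_mulVec (B : Matrix ι ι ℝ) :
    MeasurePreserving (fun z => WithLp.toLp 2 (B *ᵥ z)) (stdNormalLaw ι)
      (multivariateGaussian 0 (B * Bᵀ)) := by
  have hstd : MeasurePreserving (WithLp.toLp 2) (stdNormalLaw ι)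
      (stdGaussian (EuclideanSpace ℝ ι)) := ⟨by fun_prop, map_pi_eq_stdGaussian⟩
  have hlin : MeasurePreserving (toEuclideanCLM (𝕜 := ℝ) B) (stdGaussian (EuclideanSpace ℝ ι))
      (multivariateGaussian 0 (B * Bᵀ)) := ⟨by fun_prop, stdGaussian_map_toEuclideanCLM B⟩
  exact hlin.comp hstd

lemma measurePreserving_linearSample (n : ℕ) (B : Matrix ι ι ℝ) :
    MeasurePreserving (linearSample n B) (noiseLaw ι)
      (Measure.pi fun _ => multivariateGaussian 0 (B * Bᵀ)) := by
  have hfirst : MeasurePreserving (fun ω (m : Fin n) => ω m) (noiseLaw ι)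
      (Measure.pi fun _ => stdNormalLaw ι) := by
    refine ⟨by fun_prop, ?_⟩
    rw [← Measure.infinitePi_eq_pi]
    exact Measure.map_infinitePi_infinitePi_of_inj (P := fun _ : ℕ => stdNormalLaw ι)
      (f := fun m : Fin n => (m : ℕ)) Fin.val_injective
  exact (measurePreserving_pi _ _ fun _ => measurePreserving_toLp_mulVec B).comp hfirst

lemma one_add_inv_sqrt_smul_fluct {κ : Type*} [DecidableEq κ] {n : ℕ} (hn : 0 < n)
    (ω : ℕ → κ → ℝ) :
    1 + (√n)⁻¹ • fluct n ω =
      (n : ℝ)⁻¹ • ((of fun (m : Fin n) j => ω m j)ᵀ * of fun (m : Fin n) j => ω m j) := by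
  have hn' : (n : ℝ) ≠ 0 := by positivity
  have hsqrt : (√(n : ℝ))⁻¹ * (√(n : ℝ))⁻¹ = (n : ℝ)⁻¹ := by
    rw [← mul_inv, Real.mul_self_sqrt n.cast_nonneg]
  ext j k
  simp only [Matrix.add_apply, Matrix.smul_apply, fluct, of_apply, smul_eq_mul, mul_apply,
    transpose_apply]
  rw [← mul_assoc, hsqrt, Fin.sum_univ_eq_sum_range (fun m => ω m j * ω m k) n]
  field_simp
  ring

lemma sampleCov_linearSample {n : ℕ} (hn : 0 < n) (B : Matrix (Fin 3) (Fin 3) ℝ)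
    (ω : ℕ → Fin 3 → ℝ) :
    sampleCov n (linearSample n B ω) = B * (1 + (√n)⁻¹ • fluct n ω) * Bᵀ := by
  have hX : (of fun (m : Fin n) j => linearSample n B ω m j) =
      (of fun (m : Fin n) j => ω m j) * Bᵀ := by
    ext m j
    simp [linearSample, mul_apply, mulVec, dotProduct, mul_comm]
  rw [sampleCov_eq_smul_conjTranspose_mul, hX, one_add_inv_sqrt_smul_fluct hn,
    conjTranspose_eq_transpose_of_trivial, transpose_mul, transpose_transpose]
  simp only [Matrix.mul_assoc, Matrix.mul_smul, Matrix.smul_mul]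

end Coupling

section Cholesky

open Matrix

/-- The Cholesky factor of the correlation matrix with correlations `r = ρ₁₂`, `s = ρ₁₃`,
`t = ρ₂₃`. -/
noncomputable def cholesky (r s t : ℝ) : Matrix (Fin 3) (Fin 3) ℝ :=
  !![1, 0, 0; r, √(1 - r ^ 2), 0; s, (t - r * s) / √(1 - r ^ 2), √(corrDet r s t / (1 - r ^ 2))]

lemma cholesky_mul_transpose {r s t : ℝ} (hr : 0 < 1 - r ^ 2) (hdet : 0 ≤ corrDet r s t) :
    cholesky r s t * (cholesky r s t)ᵀ = !![1, r, s; r, 1, t; s, t, 1] := by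
  have hsqr : √(1 - r ^ 2) ^ 2 = 1 - r ^ 2 := Real.sq_sqrt hr.le
  have hsqdet : √(corrDet r s t / (1 - r ^ 2)) ^ 2 = corrDet r s t / (1 - r ^ 2) :=
    Real.sq_sqrt (by positivity)
  have hcross : √(1 - r ^ 2) * ((t - r * s) / √(1 - r ^ 2)) = t - r * s :=
    mul_div_cancel₀ _ (Real.sqrt_pos.2 hr).ne'
  have hlast : s ^ 2 + ((t - r * s) / √(1 - r ^ 2)) ^ 2 + √(corrDet r s t / (1 - r ^ 2)) ^ 2 =
      1 := by
    rw [hsqdet, div_pow, hsqr, corrDet]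
    field_simp
    ring
  unfold cholesky
  ext j k
  fin_cases j <;> fin_cases k <;> simp [mul_apply, Fin.sum_univ_three] <;> linarith

lemma tendsto_cholesky {ι : Type*} {l : Filter ι} {r s t : ι → ℝ} (hr : Tendsto r l (𝓝 0))
    (hs : Tendsto s l (𝓝 0)) (ht : Tendsto t l (𝓝 0)) :
    Tendsto (fun n => cholesky (r n) (s n) (t n)) l (𝓝 1) := by
  have hr' : Tendsto (fun n => 1 - r n ^ 2) l (𝓝 1) := by simpa using (hr.pow 2).const_sub 1
  have hdet : Tendsto (fun n => corrDet (r n) (s n) (t n)) l (𝓝 1) := by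
    simpa [corrDet] using ((hr'.sub (hs.pow 2)).sub (ht.pow 2)).add
      (((hr.const_mul 2).mul hs).mul ht)
  have hsqrt : Tendsto (fun n => √(1 - r n ^ 2)) l (𝓝 1) := by simpa using hr'.sqrt
  have hcross : Tendsto (fun n => (t n - r n * s n) / √(1 - r n ^ 2)) l (𝓝 0) := by
    simpa [Pi.div_def] using (ht.sub (hr.mul hs)).div hsqrt one_ne_zero
  have hlast : Tendsto (fun n => √(corrDet (r n) (s n) (t n) / (1 - r n ^ 2))) l (𝓝 1) := by
    simpa [Pi.div_def] using (hdet.div hr' one_ne_zero).sqrt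
  refine tendsto_pi_nhds.2 fun j => tendsto_pi_nhds.2 fun k => ?_
  fin_cases j <;> fin_cases k
  exacts [tendsto_const_nhds, tendsto_const_nhds, tendsto_const_nhds,
    hr, hsqrt, tendsto_const_nhds, hs, hcross, hlast]

lemma corr_diagonal_mul_mul_diagonal (S : Matrix (Fin 3) (Fin 3) ℝ) {d : Fin 3 → ℝ}
    (hd : ∀ j, 0 < d j) (j k : Fin 3) : corr (diagonal d * S * diagonal d) j k = corr S j k := by
  have hjk : 0 < d j * d k := mul_pos (hd j) (hd k)
  have hsqrt : √(d j * S j j * d j * (d k * S k k * d k)) = d j * d k * √(S j j * S k k) := by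
    rw [show d j * S j j * d j * (d k * S k k * d k) = (d j * d k) ^ 2 * (S j j * S k k) by ring,
      Real.sqrt_mul (sq_nonneg _), Real.sqrt_sq hjk.le]
  simp only [corr, mul_diagonal, diagonal_mul, hsqrt]
  rw [mul_right_comm, mul_div_mul_left _ _ hjk.ne']

lemma covRatio_diagonal_mul_mul_diagonal (S : Matrix (Fin 3) (Fin 3) ℝ) {d : Fin 3 → ℝ}
    (hd : ∀ j, 0 < d j) : covRatio (diagonal d * S * diagonal d) = covRatio S := by
  simp only [covRatio, corr_diagonal_mul_mul_diagonal S hd]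

lemma corr_self {S : Matrix (Fin 3) (Fin 3) ℝ} (hS : S.PosDef) (j : Fin 3) : corr S j j = 1 := by
  rw [corr, Real.sqrt_mul_self hS.diag_pos.le, div_self hS.diag_pos.ne']

lemma corr_comm {S : Matrix (Fin 3) (Fin 3) ℝ} (hS : S.PosDef) (j k : Fin 3) :
    corr S j k = corr S k j := by
  rw [corr, corr, apply_comm hS, mul_comm]

/-- The Cholesky factor of the correlation matrix of `S`. -/
noncomputable def corrFactor (S : Matrix (Fin 3) (Fin 3) ℝ) : Matrix (Fin 3) (Fin 3) ℝ :=
  cholesky (corr S 0 1) (corr S 0 2) (corr S 1 2)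

lemma corrFactor_mul_transpose {S : Matrix (Fin 3) (Fin 3) ℝ} (hS : S.PosDef) :
    corrFactor S * (corrFactor S)ᵀ = of (corr S) := by
  have hpos {j : Fin 3} : 0 < S j j := hS.diag_pos
  have hr : 0 < 1 - corr S 0 1 ^ 2 := by
    rw [one_sub_corr_sq hS]
    exact div_pos (minor_pos hS (by decide)) (mul_pos hpos hpos)
  have hdet : 0 < corrDet (corr S 0 1) (corr S 0 2) (corr S 1 2) := by
    rw [corrDet_corr hS]
    exact div_pos hS.det_pos (mul_pos (mul_pos hpos hpos) hpos)
  rw [corrFactor, cholesky_mul_transpose hr hdet.le]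
  ext j k
  fin_cases j <;> fin_cases k <;>
    simp [corr_self hS, corr_comm hS 1 0, corr_comm hS 2]

/-- A factor `B` of the covariance matrix `S = B * Bᵀ`, obtained by rescaling `corrFactor S`. -/
noncomputable def covFactor (S : Matrix (Fin 3) (Fin 3) ℝ) : Matrix (Fin 3) (Fin 3) ℝ :=
  diagonal (fun j => √(S j j)) * corrFactor S

lemma covFactor_mul_mul_transpose (S G : Matrix (Fin 3) (Fin 3) ℝ) :
    covFactor S * G * (covFactor S)ᵀ = diagonal (fun j => √(S j j)) *
      (corrFactor S * G * (corrFactor S)ᵀ) * diagonal fun j => √(S j j) := by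
  simp only [covFactor, transpose_mul, diagonal_transpose, Matrix.mul_assoc]

lemma covFactor_mul_transpose {S : Matrix (Fin 3) (Fin 3) ℝ} (hS : S.PosDef) :
    covFactor S * (covFactor S)ᵀ = S := by
  have h := covFactor_mul_mul_transpose S 1
  rw [Matrix.mul_one, Matrix.mul_one, corrFactor_mul_transpose hS] at h
  rw [h]
  ext j k
  rw [mul_diagonal, diagonal_mul, of_apply, mul_right_comm, sqrt_mul_sqrt_mul_corr hS]

end Cholesky

section Limit

open Matrix

lemma tendstoInDistribution_of_eventually_identDistrib {ι E Ω₀ : Type*} {Ω Ω' : ι → Type*}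
    [TopologicalSpace E] [MeasurableSpace E] [OpensMeasurableSpace E]
    {mΩ : ∀ i, MeasurableSpace (Ω i)} {mΩ' : ∀ i, MeasurableSpace (Ω' i)}
    {mΩ₀ : MeasurableSpace Ω₀} {μ : ∀ i, Measure (Ω i)} {ν : ∀ i, Measure (Ω' i)}
    {P : Measure Ω₀} [∀ i, IsProbabilityMeasure (μ i)] [∀ i, IsProbabilityMeasure (ν i)]
    [IsProbabilityMeasure P] {X : ∀ i, Ω i → E} {Y : ∀ i, Ω' i → E} {Z : Ω₀ → E} {l : Filter ι}
    (hX : TendstoInDistribution X l Z μ P) (hY : ∀ i, AEMeasurable (Y i) (ν i))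
    (hXY : ∀ᶠ i in l, IdentDistrib (X i) (Y i) (μ i) (ν i)) :
    TendstoInDistribution Y l Z ν P := by
  refine ⟨hY, hX.aemeasurable_limit, hX.tendsto.congr' ?_⟩
  filter_upwards [hXY] with i h
  exact Subtype.ext h.map_eq

lemma measurePreserving_linearSample_covFactor (n : ℕ) {C : Matrix (Fin 3) (Fin 3) ℝ}
    (hC : C.PosDef) :
    MeasurePreserving (linearSample n (covFactor C)) (noiseLaw (Fin 3)) (sampleLaw n C) := by
  have h := measurePreserving_linearSample n (covFactor C)
  rwa [covFactor_mul_transpose hC] at h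

lemma lrStat_linearSample_covFactor {n : ℕ} (hn : 3 ≤ n) {C : Matrix (Fin 3) (Fin 3) ℝ}
    (hC : C.PosDef) :
    (fun ω => n * Real.log
        (covRatio (corrFactor C * (1 + (√n)⁻¹ • fluct n ω) * (corrFactor C)ᵀ))) =ᵐ[noiseLaw (Fin 3)]
      fun ω => lrStat n (linearSample n (covFactor C) ω) := by
  filter_upwards [(measurePreserving_linearSample_covFactor n hC).quasiMeasurePreserving.ae
    (ae_posDef_sampleCov hn hC)] with ω hω
  rw [lrStat_eq_mul_log_covRatio hω, sampleCov_linearSample (by omega),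
    covFactor_mul_mul_transpose,
    covRatio_diagonal_mul_mul_diagonal _ fun _ => Real.sqrt_pos.2 hC.diag_pos]

variable {C : ℕ → Matrix (Fin 3) (Fin 3) ℝ} {c δ : ℝ}

lemma tendstoInMeasure_lrStat_linearSample_sub (hC : ∀ᶠ n in atTop, (C n).PosDef)
    (h12 : Tendsto (fun n : ℕ => √n * corr (C n) 0 1) atTop (𝓝 c))
    (h13 : Tendsto (fun n => corr (C n) 0 2) atTop (𝓝 0))
    (h23 : Tendsto (fun n => corr (C n) 1 2) atTop (𝓝 0))
    (hprod : Tendsto (fun n : ℕ => √n * (corr (C n) 0 2 * corr (C n) 1 2)) atTop (𝓝 δ)) :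
    TendstoInMeasure (noiseLaw (Fin 3))
      (fun n ω => lrStat n (linearSample n (covFactor (C n)) ω) -
        (δ ^ 2 - 2 * δ * (c + fluct n ω 0 1))) atTop 0 := by
  have hA : Tendsto (fun n => corrFactor (C n)) atTop (𝓝 1) :=
    tendsto_cholesky (tendsto_zero_of_tendsto_sqrt_mul tendsto_natCast_atTop_atTop h12) h13 h23
  have hcorr (j k : Fin 3) :
      ∀ᶠ n in atTop, corr (C n) j k = (corrFactor (C n) * (corrFactor (C n))ᵀ) j k :=
    hC.mono fun n hn => by rw [corrFactor_mul_transpose hn, of_apply]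
  have hunif := tendstoLocallyUniformly_mul_log_covRatio hA
    (h12.congr' ((hcorr 0 1).mono fun n h => congrArg (√n * ·) h))
    (hprod.congr' (((hcorr 0 2).and (hcorr 1 2)).mono fun n h =>
      congrArg (√n * ·) (congrArg₂ (· * ·) h.1 h.2)))
  refine (isTightFamily_fluct.tendstoInMeasure_sub hunif).congr' ?_ EventuallyEq.rfl
  filter_upwards [hC, eventually_ge_atTop 3] with n hCn hn
  exact (lrStat_linearSample_covFactor hn hCn).sub EventuallyEq.rfl

lemma tendstoInDistribution_lrStat_linearSample (hC : ∀ᶠ n in atTop, (C n).PosDef)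
    (h12 : Tendsto (fun n : ℕ => √n * corr (C n) 0 1) atTop (𝓝 c))
    (h13 : Tendsto (fun n => corr (C n) 0 2) atTop (𝓝 0))
    (h23 : Tendsto (fun n => corr (C n) 1 2) atTop (𝓝 0))
    (hprod : Tendsto (fun n : ℕ => √n * (corr (C n) 0 2 * corr (C n) 1 2)) atTop (𝓝 δ)) :
    TendstoInDistribution (fun n ω => lrStat n (linearSample n (covFactor (C n)) ω)) atTop
      (fun z : ℝ => δ * (2 * z + (δ - 2 * c))) (fun _ => noiseLaw (Fin 3))
      (gaussianReal 0 1) := by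
  have hneg : HasLaw (fun z : ℝ => -z)
      (gaussianReal 0 Var[fun z => z 0 * z 1; stdNormalLaw (Fin 3)].toNNReal)
      (gaussianReal 0 1) := by
    rw [variance_eval_mul_eval_stdNormalLaw (by decide), Real.toNNReal_one]
    exact ⟨by fun_prop, by rw [gaussianReal_map_neg, neg_zero]⟩
  have hfluct := (tendstoInDistribution_fluct_apply 0 1 hneg).continuous_comp
    (g := fun x => δ ^ 2 - 2 * δ * (c + x)) (by fun_prop)
  have hlin : (fun z : ℝ => δ * (2 * z + (δ - 2 * c))) =
      (fun x => δ ^ 2 - 2 * δ * (c + x)) ∘ fun z => -z := by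
    funext z
    simp only [Function.comp_apply]
    ring
  rw [hlin]
  exact tendstoInDistribution_of_tendstoInMeasure_sub _ _ hfluct
    (tendstoInMeasure_lrStat_linearSample_sub hC h12 h13 h23 hprod) fun n =>
      ((measurable_lrStat n).comp (measurePreserving_linearSample n _).measurable).aemeasurable

lemma tendstoInDistribution_lrStat (hC : ∀ᶠ n in atTop, (C n).PosDef)
    (h12 : Tendsto (fun n : ℕ => √n * corr (C n) 0 1) atTop (𝓝 c))
    (h13 : Tendsto (fun n => corr (C n) 0 2) atTop (𝓝 0))
    (h23 : Tendsto (fun n => corr (C n) 1 2) atTop (𝓝 0))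
    (hprod : Tendsto (fun n : ℕ => √n * (corr (C n) 0 2 * corr (C n) 1 2)) atTop (𝓝 δ)) :
    TendstoInDistribution (fun n => lrStat n) atTop (fun z : ℝ => δ * (2 * z + (δ - 2 * c)))
      (fun n => sampleLaw n (C n)) (gaussianReal 0 1) := by
  refine tendstoInDistribution_of_eventually_identDistrib
    (tendstoInDistribution_lrStat_linearSample hC h12 h13 h23 hprod)
    (fun n => (measurable_lrStat n).aemeasurable) (hC.mono fun n hn => ?_)
  have hmp := measurePreserving_linearSample_covFactor n hn
  refine ⟨((measurable_lrStat n).comp hmp.measurable).aemeasurable,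
    (measurable_lrStat n).aemeasurable, ?_⟩
  rw [← hmp.map_eq, Measure.map_map (measurable_lrStat n) hmp.measurable]
  rfl

lemma gaussianReal_map_mul_add (a b m : ℝ) :
    (gaussianReal 0 1).map (fun z => a * (b * z + m)) =
      gaussianReal (a * m) ((b * a) ^ 2).toNNReal := by
  have hcomp : (fun z : ℝ => a * (b * z + m)) = (· + a * m) ∘ (b * a * ·) := by
    funext z
    simp only [Function.comp_apply]
    ring
  rw [hcomp, ← Measure.map_map (by fun_prop) (by fun_prop), gaussianReal_map_const_mul,
    gaussianReal_map_add_const, mul_zero, zero_add, mul_one]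
  congr 1
  ext
  rw [NNReal.coe_mk, Real.coe_toNNReal _ (sq_nonneg _)]

end Limit

section Models

lemma corr_zero_one_of_mem_model {i : Fin 2} {C : Matrix (Fin 3) (Fin 3) ℝ} (hC : C ∈ model i) :
    corr C 0 1 = (i : ℕ) * (corr C 0 2 * corr C 1 2) := by
  have hpd := posDef_of_mem_model hC
  fin_cases i
  · have h01 : C 0 1 = 0 := hC.2
    simp [corr, h01]
  · have h01 : C 0 1 * C 2 2 = C 0 2 * C 1 2 := hC.2
    have hsqrt (k : Fin 3) : 0 < √(C k k) := Real.sqrt_pos.2 hpd.diag_pos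
    have hsq : √(C 2 2) * √(C 2 2) = C 2 2 := Real.mul_self_sqrt hpd.diag_pos.le
    have hne : √(C 0 0) * √(C 1 1) * C 2 2 ≠ 0 :=
      (mul_pos (mul_pos (hsqrt 0) (hsqrt 1)) hpd.diag_pos).ne'
    rw [← sqrt_mul_sqrt_mul_corr hpd 0 1, ← sqrt_mul_sqrt_mul_corr hpd 0 2,
      ← sqrt_mul_sqrt_mul_corr hpd 1 2] at h01
    refine mul_left_cancel₀ hne ?_
    simp only [Nat.cast_one, one_mul]
    linear_combination h01 + √(C 0 0) * √(C 1 1) * corr C 0 2 * corr C 1 2 * hsq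

lemma tendsto_sqrt_mul_of_isLittleO {a : ℕ → ℝ} {δ : ℝ}
    (h : (fun n : ℕ => a n - δ * (n : ℝ) ^ (-(1 / 2) : ℝ)) =o[atTop]
      fun n : ℕ => (n : ℝ) ^ (-(1 / 2) : ℝ)) :
    Tendsto (fun n : ℕ => √n * a n) atTop (𝓝 δ) := by
  have hdiv := h.tendsto_div_nhds_zero.add_const δ
  rw [zero_add] at hdiv
  refine hdiv.congr' ?_
  filter_upwards [eventually_gt_atTop 0] with n hn
  have hsqrt : √(n : ℝ) ≠ 0 := by positivity
  rw [Real.rpow_neg n.cast_nonneg, ← Real.sqrt_eq_rpow]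
  field_simp
  ring

end Models

end TrivariateGaussian

open TrivariateGaussian in
theorem mainTheorem3_general {C : ℕ → Matrix (Fin 3) (Fin 3) ℝ} {c δ : ℝ}
    (hC : ∀ n, 1 ≤ n → (C n).PosDef)
    (h12 : Tendsto (fun n : ℕ => √n * corr (C n) 0 1) atTop (𝓝 c))
    (h13 : Tendsto (fun n => corr (C n) 0 2) atTop (𝓝 0))
    (h23 : Tendsto (fun n => corr (C n) 1 2) atTop (𝓝 0))
    (hprod : Tendsto (fun n : ℕ => √n * (corr (C n) 0 2 * corr (C n) 1 2)) atTop (𝓝 δ)) :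
    (∀ n, 3 ≤ n → ∀ᵐ x ∂sampleLaw n (C n), ∀ j : Fin 2,
      BddAbove (logLik n (sampleCov n x) '' model j)) ∧
    TendstoInDistribution (fun n => lrStat n) atTop (fun z : ℝ => δ * (2 * z + (δ - 2 * c)))
      (fun n => sampleLaw n (C n)) (gaussianReal 0 1) ∧
    (gaussianReal 0 1).map (fun z : ℝ => δ * (2 * z + (δ - 2 * c))) =
      gaussianReal (δ * (δ - 2 * c)) ((2 * δ) ^ 2).toNNReal := by
  refine ⟨fun n hn => ?_, tendstoInDistribution_lrStat ?_ h12 h13 h23 hprod,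
    gaussianReal_map_mul_add _ _ _⟩
  · filter_upwards [ae_posDef_sampleCov hn (hC n (by omega))] with x hx j
    exact bddAbove_logLik_image_model n j hx
  · filter_upwards [eventually_ge_atTop 1] using hC

open TrivariateGaussian in
theorem mainTheorem3 (i : Fin 2) (δ : ℝ) (hδ : δ ≠ 0)
    (C : ℕ → Matrix (Fin 3) (Fin 3) ℝ)
    (hC : ∀ n, 1 ≤ n → C n ∈ TrivariateGaussian.model i \ TrivariateGaussian.model (1 - i))
    (h13 : Tendsto (fun n => TrivariateGaussian.corr (C n) 0 2) atTop (𝓝 0))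
    (h23 : Tendsto (fun n => TrivariateGaussian.corr (C n) 1 2) atTop (𝓝 0))
    (hprod : (fun n : ℕ => TrivariateGaussian.corr (C n) 0 2 * TrivariateGaussian.corr (C n) 1 2
        - δ * (n : ℝ) ^ (-(1 / 2) : ℝ)) =o[atTop] fun n : ℕ => (n : ℝ) ^ (-(1 / 2) : ℝ)) :
    -- the suprema defining the statistic are almost surely finite
    (∀ n, 3 ≤ n → ∀ᵐ x ∂TrivariateGaussian.sampleLaw n (C n), ∀ j : Fin 2,
      BddAbove (TrivariateGaussian.logLik n (TrivariateGaussian.sampleCov n x) ''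
        TrivariateGaussian.model j)) ∧
    -- convergence in law to `δ (2 Z + (-1)ⁱ δ)` with `Z` standard normal
    TendstoInDistribution (fun n => TrivariateGaussian.lrStat n) atTop
      (fun z : ℝ => δ * (2 * z + (-1) ^ (i : ℕ) * δ))
      (fun n => TrivariateGaussian.sampleLaw n (C n)) (gaussianReal 0 1) ∧
    -- the law of the limit
    (gaussianReal 0 1).map (fun z : ℝ => δ * (2 * z + (-1) ^ (i : ℕ) * δ)) =
      gaussianReal ((-1) ^ (i : ℕ) * δ ^ 2) ((2 * δ) ^ 2).toNNReal := by
  have hrate := tendsto_sqrt_mul_of_isLittleO hprod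
  have h12 : Tendsto (fun n : ℕ => √n * corr (C n) 0 1) atTop (𝓝 ((i : ℕ) * δ)) := by
    refine (hrate.const_mul ((i : ℕ) : ℝ)).congr' ?_
    filter_upwards [eventually_ge_atTop 1] with n hn
    rw [corr_zero_one_of_mem_model (hC n hn).1]
    ring
  have hsign : (-1 : ℝ) ^ (i : ℕ) * δ = δ - 2 * ((i : ℕ) * δ) := by
    fin_cases i <;> simp; ring
  rw [sq δ, ← mul_assoc, hsign, mul_comm (δ - _) δ]
  exact mainTheorem3_general (fun n hn => posDef_of_mem_model (hC n hn).1) h12 h13 h23 hrate
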